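/- For $x\in\mathbb{R}$ let $\|x\|$ be the distance from $x$ to the nearest integer, and let $|\cdot|$ be the Euclidean norm on $\mathbb{R}^2$. A sequence $(q_n,\mathbf{p}_n)\in\mathbb{N}\times\mathbb{Z}^2$, $n\ge 0$ (where $\mathbb{N}=\{1,2,\dots\}$), is called a sequence of best approximations for $\mathbf{v}=(v_1,v_2)\in\mathbb{R}^2$ if 1. $q_0=1$; 2. for every $n\ge 0$, $q_{n+1}=\min\{q\in\mathbb{N} : \sqrt{\|qv_1\|^2+\|qv_2\|^2}<\sqrt{\|q_nv_1\|^2+\|q_nv_2\|^2}\}$ (in particular, this set is non-empty); 3. for every $n\ge 0$, $\mathbf{p}_n=(p_{n,1},p_{n,2})$ satisfies $|q_nv_i-p_{n,i}|=\|q_nv_i\|$ for $i=1,2$. For $n\ge 1$ put $V_n=\pi q_n\,|q_{n-1}\mathbf{v}-\mathbf{p}_{n-1}|^2$, the volume of the cylinder $\{(x,\mathbf{y})\in\mathbb{R}\times\mathbb{R}^2 : 0\le x\le q_n,\ |x\mathbf{v}-\mathbf{y}|\le |q_{n-1}\mathbf{v}-\mathbf{p}_{n-1}|\}$. **Theorem.**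 Let $(\Delta_n)_{n\ge 1}$ be an arbitrary sequence of non-degenerate intervals (open, closed or half-open, with more than one point) contained in $\left[0,\tfrac{2}{\sqrt3}\right]$. Then the set of vectors $\mathbf{v}\in\mathbb{R}^2$ that have an (infinite) sequence of best approximations with $$\tfrac1\pi V_n=q_n\,|q_{n-1}\mathbf{v}-\mathbf{p}_{n-1}|^2\in\Delta_n\qquad\text{for all } n\ge 1$$ has the cardinality of the continuum. -/

import Mathlib

/-- The distance `‖x‖` from a real number to the nearest integer. -/
noncomputable def distInt (x : ℝ) : ℝ := |x - round x|

/-- `√(‖q v₁‖² + ‖q v₂‖²)`, the Euclidean distance from `q v` to the lattice `ℤ²`. -/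
noncomputable def latticeDist (v : EuclideanSpace ℝ (Fin 2)) (q : ℕ) : ℝ :=
  √(distInt (q * v 0) ^ 2 + distInt (q * v 1) ^ 2)

/-- The integer vector `p` as a vector of the Euclidean plane. -/
noncomputable def intVec (p : Fin 2 → ℤ) : EuclideanSpace ℝ (Fin 2) :=
  WithLp.toLp 2 (fun i => (p i : ℝ))

/-- `(q n, p n)`, `n ≥ 0`, is an (infinite) sequence of best approximations to `v` with respect to
the Euclidean norm. The natural numbers over which the minimum is taken are the positive ones. -/
structure IsBestApproxSeq (v : EuclideanSpace ℝ (Fin 2)) (q : ℕ → ℕ) (p : ℕ → Fin 2 → ℤ) :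
    Prop where
  q_zero : q 0 = 1
  q_succ : ∀ n, IsLeast {m : ℕ | 1 ≤ m ∧ latticeDist v m < latticeDist v (q n)} (q (n + 1))
  p_nearest : ∀ n i, |(q n : ℝ) * v i - (p n i : ℝ)| = distInt ((q n : ℝ) * v i)

/-- The radii `R₀ = 1` and `Rₙ = |qₙ₋₁ v - pₙ₋₁|` for `n ≥ 1` (Euclidean norm). -/
noncomputable def cylRadius (v : EuclideanSpace ℝ (Fin 2)) (q : ℕ → ℕ) (p : ℕ → Fin 2 → ℤ) :
    ℕ → ℝ
  | 0 => 1
  | n + 1 => ‖(q n : ℝ) • v - intVec (p n)‖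

/-- The volume `Vₙ = π qₙ Rₙ²` of the cylinder
`Πₙ = {(x, y) ∈ ℝ × ℝ² | 0 ≤ x ≤ qₙ, |x v - y| ≤ Rₙ}`. -/
noncomputable def cylVolume (v : EuclideanSpace ℝ (Fin 2)) (q : ℕ → ℕ) (p : ℕ → Fin 2 → ℤ)
    (n : ℕ) : ℝ :=
  Real.pi * (q n : ℝ) * cylRadius v q p n ^ 2

/-! The vector is the common point of nested closed discs about rational points `p / q`. Given a
basis `z = (q, p)`, `u`, `w` of `ℤ³`, the next point comes from `z' = k u + w + j z`; put `c = p' /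
q'`. Projected along `z'`, `ℤ³` becomes a planar lattice of covolume `1 / q'`, and `z` maps to `q c
- p`. If this image is shortest up to sign, only `q` and `q' - q` attain its length below `q'`, and
the normalized volume at `c` is `q' |q c - p|²`. Hermite's constant `2 / √3` bounds it, and every
value below is approachable: for large `k`, the choice of `j` puts the volume in a given interval
while `u` projects almost halfway between multiples of `z` (`eventually_exists_int_combination`). At
`c` itself `q` and `q' - q` tie. Moving `v` into the half-disc facing away from `q c - p` favours
`q` (`eventually_isNextBestApprox`); the other inequalities are strict and survive by continuity.
Each new disc must therefore fit inside the previous half-disc (`exists_next_halfDisc`). Two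
disjoint target intervals at each step give a binary tree of vectors, separated by their volumes. -/

/-! ### Shortest vectors of the projected lattice. -/

theorem four_le_sq {d : ℤ} (h : d < -1 ∨ 1 < d) : 4 ≤ d ^ 2 := by
  rcases h with h | h <;> nlinarith

theorem sq_lt_sq_add_mul_sq {N Q c z : ℤ} (hN : 0 < N) (hNQ : N < 2 * Q) (hc : 4 ≤ c) :
    N ^ 2 < z ^ 2 + c * Q ^ 2 := by
  have h1 : N ^ 2 < (2 * Q) ^ 2 := pow_lt_pow_left₀ hNQ hN.le two_ne_zero
  have h2 : 4 * Q ^ 2 ≤ c * Q ^ 2 := mul_le_mul_of_nonneg_right hc (sq_nonneg Q)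
  linarith [sq_nonneg z, show (2 * Q) ^ 2 = 4 * Q ^ 2 by ring]

/-- For combinations of `z` and `z'` alone: with first coordinate in `(0, Q)`, coefficient `0` of
`z` is impossible, and `1`, `-1` force the two excluded values. -/
theorem lt_neg_one_or_one_lt {a b q Q : ℤ} (hq : 0 < q) (hqQ : q < Q) (h0 : 0 < a * q + b * Q)
    (hQ : a * q + b * Q < Q) (h1 : a * q + b * Q ≠ q) (h2 : a * q + b * Q ≠ Q - q) :
    a < -1 ∨ 1 < a := by
  by_contra! hcon
  obtain ⟨h3, h4⟩ := hcon
  have hQ0 : 0 < Q := by omega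
  interval_cases a
  · have : 0 < b := by by_contra!; nlinarith
    have : b < 2 := by by_contra!; nlinarith
    have : b = 1 := by omega
    subst this; omega
  · have : 0 < b := by by_contra!; nlinarith
    have : b < 1 := by by_contra!; nlinarith
    omega
  · have : -1 < b := by by_contra!; nlinarith
    have : b < 1 := by by_contra!; nlinarith
    have : b = 0 := by omega
    subst this; omega

/-- If `(z', z, u)` is a basis of `ℤ³` whose projection along `z' = (Q, X, Y)` is a lattice in which
the image of `z = (q, x, y)` is the shortest vector up to sign, then among `0 < m < Q` only `m = q`
and `m = Q - q` approximate `(X / Q, Y / Q)` as well as `q` does. -/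
theorem lt_sq_add_sq_of_det_eq_one {q x y Q X Y U S T m s t N I : ℤ}
    (hdet : Q * (x * T - y * S) - X * (q * T - y * U) + Y * (q * S - x * U) = 1)
    (hN : N = (q * X - Q * x) ^ 2 + (q * Y - Q * y) ^ 2)
    (hI : I = (q * X - Q * x) * (U * X - Q * S) + (q * Y - Q * y) * (U * Y - Q * T))
    (hN0 : 0 < N) (hNQ : N < 2 * Q) (hIN : ∀ a : ℤ, N ^ 2 < (I + a * N) ^ 2 + Q ^ 2)
    (hm : 0 < m) (hmQ : m < Q) (hmq : m ≠ q) (hmQq : m ≠ Q - q)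
    (hq : 0 < q) (hqQ : q < Q) :
    N < (m * X - Q * s) ^ 2 + (m * Y - Q * t) ^ 2 := by
  obtain ⟨a, ha⟩ : ∃ a, a = Q * (s * T - t * S) - X * (m * T - t * U) + Y * (m * S - s * U) :=
    ⟨_, rfl⟩
  obtain ⟨b, hb⟩ : ∃ b, b = m * (x * T - y * S) - s * (q * T - y * U) + t * (q * S - x * U) :=
    ⟨_, rfl⟩
  obtain ⟨d, hd⟩ : ∃ d, d = Q * (x * t - y * s) - X * (q * t - y * m) + Y * (q * s - x * m) :=
    ⟨_, rfl⟩
  have e1 : m = a * q + b * Q + d * U := by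
    rw [ha, hb, hd]; linear_combination (-m) * hdet
  have e2 : s = a * x + b * X + d * S := by
    rw [ha, hb, hd]; linear_combination (-s) * hdet
  have e3 : t = a * y + b * Y + d * T := by
    rw [ha, hb, hd]; linear_combination (-t) * hdet
  -- Lagrange's identity for the projections of `z` and `(m, s, t)`, scaled by `Q`; those of `z` and
  -- `u` span area `Q`.
  have key : N * ((m * X - Q * s) ^ 2 + (m * Y - Q * t) ^ 2) = (a * N + d * I) ^ 2 + d ^ 2 * Q ^ 2 := by
    have hc : ((q * X - Q * x) * (U * Y - Q * T) - (q * Y - Q * y) * (U * X - Q * S)) ^ 2 = Q ^ 2 := by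
      have : (q * X - Q * x) * (U * Y - Q * T) - (q * Y - Q * y) * (U * X - Q * S) = Q := by
        linear_combination Q * hdet
      rw [this]
    rw [e1, e2, e3]
    rw [← hc, hI, hN]
    ring
  have main : N ^ 2 < (a * N + d * I) ^ 2 + d ^ 2 * Q ^ 2 := by
    rcases lt_trichotomy d 0 with h | h | h
    · rcases eq_or_lt_of_le (show d ≤ -1 by omega) with h1 | h1
      · have := hIN (-a)
        rw [h1]; linarith [this, show (a * N + -1 * I) ^ 2 = (I + -a * N) ^ 2 by ring]
      · exact sq_lt_sq_add_mul_sq hN0 hNQ (four_le_sq (.inl h1))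
    · rw [h, zero_mul, add_zero] at e1
      rw [h]
      have ha2 : 4 ≤ a ^ 2 := four_le_sq <| lt_neg_one_or_one_lt hq hqQ (e1 ▸ hm) (e1 ▸ hmQ)
        (e1 ▸ hmq) (e1 ▸ hmQq)
      have : 4 * N ^ 2 ≤ a ^ 2 * N ^ 2 := mul_le_mul_of_nonneg_right ha2 (sq_nonneg N)
      linarith [pow_pos hN0 2, show (a * N + 0 * I) ^ 2 + 0 ^ 2 * Q ^ 2 = a ^ 2 * N ^ 2 by ring]
    · rcases eq_or_lt_of_le (show 1 ≤ d by omega) with h1 | h1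
      · have := hIN a
        rw [← h1]; linarith [this, show (a * N + 1 * I) ^ 2 = (I + a * N) ^ 2 by ring]
      · exact sq_lt_sq_add_mul_sq hN0 hNQ (four_le_sq (.inr h1))
  rw [← key, sq] at main
  exact lt_of_mul_lt_mul_left main hN0.le

/-! ### Choice of the next denominator. -/

/-- An arithmetic progression with small step `-σ`, sampled on an interval longer than `1 / σ + 2`,
comes close to `1 / 2` modulo `1`. -/
theorem exists_int_near_half {σ τ x y : ℝ} (hσ : 0 < σ) (hxy : 1 / σ + 2 ≤ y - x) :
    ∃ j : ℤ, x < j ∧ j < y ∧ ∀ i : ℤ, 1 / 2 - σ ≤ |τ - j * σ + i| := by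
  set i₀ : ℤ := ⌊τ - σ * (x + 1) - 1 / 2⌋
  have h1 := Int.floor_le (τ - σ * (x + 1) - 1 / 2)
  have h2 := Int.lt_floor_add_one (τ - σ * (x + 1) - 1 / 2)
  change (i₀ : ℝ) ≤ _ at h1
  change _ < (i₀ : ℝ) + 1 at h2
  -- `c` is the real index at which the progression equals `1 / 2 + i₀`; rounding it down costs at
  -- most one step `σ`.
  obtain ⟨c, hc⟩ : ∃ c, c = (τ - i₀ - 1 / 2) / σ := ⟨_, rfl⟩
  have hcσ : c * σ = τ - i₀ - 1 / 2 := by rw [hc]; field_simp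
  have hc1 : x + 1 ≤ c := by
    rw [hc, le_div_iff₀ hσ]; linarith
  have hc2 : c < x + 1 + 1 / σ := by
    rw [hc, div_lt_iff₀ hσ, add_mul, one_div_mul_cancel hσ.ne']; linarith
  have f1 := Int.floor_le c
  have f2 := Int.lt_floor_add_one c
  refine ⟨⌊c⌋, by linarith, by linarith, fun i => ?_⟩
  have g1 : 0 ≤ (c - ⌊c⌋) * σ := mul_nonneg (by linarith) hσ.le
  have g2 : (c - ⌊c⌋) * σ ≤ σ := by nlinarith
  have g3 : τ - ⌊c⌋ * σ + i = (c - ⌊c⌋) * σ + 1 / 2 + ((i₀ + i : ℤ) : ℝ) := by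
    push_cast; linarith
  rw [g3]
  rcases le_or_gt 0 (i₀ + i) with h | h
  · have : (0 : ℝ) ≤ ((i₀ + i : ℤ) : ℝ) := by exact_mod_cast h
    rw [abs_of_nonneg (by linarith)]; linarith
  · have : ((i₀ + i : ℤ) : ℝ) ≤ -1 := by exact_mod_cast (show i₀ + i ≤ -1 by omega)
    have := neg_abs_le ((c - ⌊c⌋) * σ + 1 / 2 + ((i₀ + i : ℤ) : ℝ))
    linarith

-- `N` does not depend on `j`, so `a < N / Q < b` leaves a range of `j` of length `κ N`, of order
-- `k²`. Meanwhile `I / N` moves by `P / N`, of order `1 / k`, per step, so some `j` in the range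
-- brings it near `1 / 2` modulo `1`. Then `I + i N` has square at least about `N² / 4`, and `b² < 4
-- / 3` suffices.
open Filter in
theorem eventually_exists_int_combination (A₁ A₂ B₁ B₂ C₁ C₂ U W q : ℤ) (hA : 0 < A₁ ^ 2 + A₂ ^ 2)
    (hq : 0 < q) {a b : ℝ} (ha : 0 < a) (hab : a < b) (hb : b ^ 2 < 4 / 3) (K : ℝ) :
    ∀ᶠ k : ℕ in atTop, ∃ j Q N I : ℤ, Q = k * U + W + j * q ∧
      N = (k * A₁ + B₁) ^ 2 + (k * A₂ + B₂) ^ 2 ∧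
      I = (k * A₁ + B₁) * (C₁ - j * A₁) + (k * A₂ + B₂) * (C₂ - j * A₂) ∧
      a * Q < N ∧ N < b * Q ∧ K ≤ Q ∧ 0 < N ∧ ∀ i : ℤ, N ^ 2 < (I + i * N) ^ 2 + Q ^ 2 := by
  obtain ⟨g, hg⟩ : ∃ g : ℝ, g = A₁ ^ 2 + A₂ ^ 2 := ⟨_, rfl⟩
  have hg0 : 0 < g := by rw [hg]; exact_mod_cast hA
  have hq0 : (0 : ℝ) < q := by exact_mod_cast hq
  have hb0 : 0 < b := ha.trans hab
  obtain ⟨κ, hκ⟩ : ∃ κ : ℝ, κ = (1 / a - 1 / b) / q := ⟨_, rfl⟩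
  have hκ0 : 0 < κ := by
    rw [hκ]; exact div_pos (sub_pos.2 (one_div_lt_one_div_of_lt ha hab)) hq0
  -- Small enough that `b² (3 / 4 + ε) ≤ 1`; `ε` will bound the step `σ`.
  obtain ⟨ε, hε⟩ : ∃ ε : ℝ, ε = min (1 / 4) ((4 / 3 - b ^ 2) / 4) := ⟨_, rfl⟩
  have hε0 : 0 < ε := by rw [hε]; exact lt_min (by norm_num) (by linarith)
  have hε1 : ε ≤ 1 / 4 := by rw [hε]; exact min_le_left _ _
  have hε2 : ε ≤ (4 / 3 - b ^ 2) / 4 := by rw [hε]; exact min_le_right _ _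
  have hP : Tendsto (fun k : ℕ => (k : ℝ) * g + (A₁ * B₁ + A₂ * B₂ : ℝ)) atTop atTop :=
    tendsto_atTop_add_const_right _ _
      (tendsto_natCast_atTop_atTop.atTop_mul_const hg0)
  filter_upwards [hP.eventually_ge_atTop 1, hP.eventually_ge_atTop (2 / κ),
    hP.eventually_ge_atTop (4 / κ * g), hP.eventually_ge_atTop (g / ε),
    hP.eventually_ge_atTop (g * b * K)] with k h1 h2 h3 h4 h5
  obtain ⟨P, hPd⟩ : ∃ P : ℝ, P = (k : ℝ) * g + (A₁ * B₁ + A₂ * B₂ : ℝ) := ⟨_, rfl⟩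
  rw [← hPd] at h1 h2 h3 h4 h5
  obtain ⟨N, hN⟩ : ∃ N : ℤ, N = (k * A₁ + B₁) ^ 2 + (k * A₂ + B₂) ^ 2 := ⟨_, rfl⟩
  have hNr : (N : ℝ) = (k * A₁ + B₁) ^ 2 + (k * A₂ + B₂) ^ 2 := by rw [hN]; push_cast; ring
  have hCS : P ^ 2 ≤ g * N := by
    rw [hNr, hPd, hg]
    nlinarith [sq_nonneg ((A₁ : ℝ) * (k * A₂ + B₂) - A₂ * (k * A₁ + B₁))]
  have hP0 : 0 < P := by linarith
  have hPN : P ≤ g * N := (le_self_pow₀ h1 two_ne_zero).trans hCS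
  have hN0 : (0 : ℝ) < N := pos_of_mul_pos_right (hP0.trans_le hPN) hg0.le
  obtain ⟨σ, hσ⟩ : ∃ σ : ℝ, σ = P / N := ⟨_, rfl⟩
  have hσ0 : 0 < σ := by rw [hσ]; positivity
  have hσN : σ * N = P := by rw [hσ]; field_simp
  have hσε : σ ≤ ε := by
    rw [hσ, div_le_iff₀ hN0]
    rw [div_le_iff₀ hε0] at h4
    have h8 : P * P ≤ P * (ε * N) := calc
      P * P ≤ g * N := by rw [← sq]; exact hCS
      _ ≤ P * ε * N := mul_le_mul_of_nonneg_right h4 hN0.le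
      _ = P * (ε * N) := by ring
    exact le_of_mul_le_mul_left h8 hP0
  obtain ⟨τ, hτ⟩ : ∃ τ : ℝ, τ = ((k * A₁ + B₁) * C₁ + (k * A₂ + B₂) * C₂) / N := ⟨_, rfl⟩
  have hτN : τ * N = (k * A₁ + B₁) * C₁ + (k * A₂ + B₂) * C₂ := by rw [hτ]; field_simp
  have hlen : 1 / σ + 2 ≤ (N / a - k * U - W) / q - (N / b - k * U - W) / q := by
    have e1 : (N / a - k * U - W) / q - (N / b - k * U - W) / q = κ * N := by
      rw [hκ]; field_simp; ring
    rw [e1, hσ, one_div_div]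
    have t1 : (N : ℝ) / P ≤ κ / 2 * N := by
      rw [div_le_iff₀ hP0]
      rw [div_le_iff₀ hκ0] at h2
      have : 2 * (N : ℝ) ≤ P * κ * N := mul_le_mul_of_nonneg_right h2 hN0.le
      linarith
    have t2 : 2 ≤ κ / 2 * N := by
      have : 4 / κ * g ≤ g * N := h3.trans hPN
      have : 4 / κ ≤ N := le_of_mul_le_mul_left (by linarith) hg0
      rw [div_le_iff₀ hκ0] at this
      linarith
    linarith
  obtain ⟨j, hj1, hj2, hj3⟩ := exists_int_near_half (τ := τ) hσ0 hlen
  obtain ⟨Q, hQ⟩ : ∃ Q : ℤ, Q = k * U + W + j * q := ⟨_, rfl⟩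
  have hQr : (Q : ℝ) = k * U + W + j * q := by rw [hQ]; push_cast; ring
  rw [div_lt_iff₀ hq0] at hj1
  rw [lt_div_iff₀ hq0] at hj2
  have hbQ : (N : ℝ) < b * Q := by
    rw [← div_lt_iff₀' hb0]; linarith
  have haQ : a * Q < N := by
    rw [← lt_div_iff₀' ha]; linarith
  have hQ0 : (0 : ℝ) < Q := pos_of_mul_pos_right (hN0.trans hbQ) hb0.le
  refine ⟨j, Q, N, _, hQ, hN, rfl, haQ, hbQ, ?_, by exact_mod_cast hN0, fun i => ?_⟩
  · have h8 : P ≤ g * (b * Q) := hPN.trans (mul_le_mul_of_nonneg_left hbQ.le hg0.le)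
    have : g * b * K ≤ g * b * Q := by linarith
    exact le_of_mul_le_mul_left this (by positivity)
  · have e : ((k * A₁ + B₁) * (C₁ - j * A₁) + (k * A₂ + B₂) * (C₂ - j * A₂) + i * N : ℝ)
        = (τ - j * σ + i) * N := by
      have e2 : (τ - j * σ + i) * N = τ * N - j * (σ * N) + i * N := by ring
      rw [e2, hτN, hσN, hPd, hg]; ring
    have h7 : (N : ℝ) ^ 2 < ((k * A₁ + B₁) * (C₁ - j * A₁) + (k * A₂ + B₂) * (C₂ - j * A₂)
        + i * N : ℝ) ^ 2 + (Q : ℝ) ^ 2 := by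
      rw [e]
      have hs : (1 / 2 - σ) ^ 2 ≤ (τ - j * σ + i) ^ 2 := by
        rw [← sq_abs (τ - j * σ + i)]
        exact pow_le_pow_left₀ (by linarith) (hj3 i) 2
      have hs2 : (1 / 4 - ε) ≤ (1 / 2 - σ) ^ 2 := by
        linarith [sq_nonneg σ, show (1 / 2 - σ) ^ 2 = 1 / 4 - σ + σ ^ 2 by ring]
      have hNQ : (N : ℝ) ^ 2 < b ^ 2 * Q ^ 2 := by
        rw [← mul_pow]; exact pow_lt_pow_left₀ hbQ hN0.le two_ne_zero
      have hbε : b ^ 2 * (3 / 4 + ε) ≤ 1 := by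
        have := mul_le_mul_of_nonneg_right hb.le hε0.le
        linarith
      have u1 : (N : ℝ) ^ 2 * (3 / 4 + ε) < b ^ 2 * Q ^ 2 * (3 / 4 + ε) :=
        mul_lt_mul_of_pos_right hNQ (by linarith)
      have u2 : (b ^ 2 * (3 / 4 + ε)) * (Q : ℝ) ^ 2 ≤ 1 * (Q : ℝ) ^ 2 :=
        mul_le_mul_of_nonneg_right hbε (sq_nonneg _)
      have u3 : (1 / 4 - ε) * (N : ℝ) ^ 2 ≤ (τ - j * σ + i) ^ 2 * (N : ℝ) ^ 2 :=
        mul_le_mul_of_nonneg_right (hs2.trans hs) (sq_nonneg _)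
      rw [mul_pow]
      linarith
    exact_mod_cast h7

/-! ### Distance to the integer lattice. -/

theorem continuous_distInt : Continuous distInt := by
  have : distInt = fun x : ℝ => ‖(x : UnitAddCircle)‖ := by
    funext x; rw [UnitAddCircle.norm_eq]; rfl
  rw [this]
  exact continuous_norm.comp (AddCircle.continuous_mk' (1 : ℝ))

theorem continuous_latticeDist (m : ℕ) : Continuous fun v => latticeDist v m := by
  unfold latticeDist
  have := continuous_distInt
  fun_prop

theorem distInt_eq_of_abs_sub_lt {x : ℝ} {n : ℤ} (h : |x - n| < 1 / 2) : distInt x = |x - n| := by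
  have : round x = n := by
    have h1 := abs_sub_round x
    have h2 : |((round x - n : ℤ) : ℝ)| < 1 := by
      have : ((round x - n : ℤ) : ℝ) = (x - n) - (x - round x) := by push_cast; ring
      rw [this]
      exact (abs_sub _ _).trans_lt (by linarith)
    have h3 : |round x - n| < 1 := by exact_mod_cast h2
    have := Int.abs_lt_one_iff.1 h3
    omega
  rw [distInt, this]

theorem norm_smul_sub_intVec (v : EuclideanSpace ℝ (Fin 2)) (c : ℝ) (p : Fin 2 → ℤ) :
    ‖c • v - intVec p‖ = √((c * v 0 - p 0) ^ 2 + (c * v 1 - p 1) ^ 2) := by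
  simp [EuclideanSpace.norm_eq, Fin.sum_univ_two, intVec]

theorem latticeDist_eq_of_nearest {v : EuclideanSpace ℝ (Fin 2)} {m : ℕ} {p : Fin 2 → ℤ}
    (h : ∀ i, |(m : ℝ) * v i - (p i : ℝ)| = distInt (m * v i)) :
    latticeDist v m = ‖(m : ℝ) • v - intVec p‖ := by
  rw [norm_smul_sub_intVec, latticeDist, ← h 0, ← h 1, sq_abs, sq_abs]

theorem latticeDist_eq_norm_round (v : EuclideanSpace ℝ (Fin 2)) (m : ℕ) :
    latticeDist v m = ‖(m : ℝ) • v - intVec (fun i => round ((m : ℝ) * v i))‖ :=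
  latticeDist_eq_of_nearest fun _ => rfl

theorem abs_mul_sub_le_norm (v : EuclideanSpace ℝ (Fin 2)) (c : ℝ) (p : Fin 2 → ℤ) (i : Fin 2) :
    |c * v i - p i| ≤ ‖c • v - intVec p‖ := by
  have := PiLp.norm_apply_le (c • v - intVec p) i
  simpa [intVec] using this

theorem nearest_of_norm_lt_half {v : EuclideanSpace ℝ (Fin 2)} {m : ℕ} {p : Fin 2 → ℤ}
    (h : ‖(m : ℝ) • v - intVec p‖ < 1 / 2) (i : Fin 2) :
    |(m : ℝ) * v i - (p i : ℝ)| = distInt (m * v i) :=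
  (distInt_eq_of_abs_sub_lt ((abs_mul_sub_le_norm v m p i).trans_lt h)).symm

/-! ### Half-discs and the inductive step. -/

/-- The point `p / q` of the plane. -/
noncomputable def ratVec (q : ℕ) (p : Fin 2 → ℤ) : EuclideanSpace ℝ (Fin 2) :=
  (q : ℝ)⁻¹ • intVec p

/-- The open half of the disc of radius `r` about `c` that faces away from `e`. -/
def openHalfDisc (c e : EuclideanSpace ℝ (Fin 2)) (r : ℝ) : Set (EuclideanSpace ℝ (Fin 2)) :=
  {v | ‖v - c‖ < r ∧ inner ℝ (v - c) e < 0}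

/-- `(q, p)` can be completed to a basis of `ℤ³`. -/
def ExtendsToBasis (q : ℕ) (p : Fin 2 → ℤ) : Prop :=
  ∃ U S T W V R : ℤ, q * (S * R - T * V) - p 0 * (U * R - T * W) + p 1 * (U * V - S * W) = 1

/-- `p` is nearest to `q v`, and `q'` follows `q` among the denominators of best approximations. -/
def IsNextBestApprox (v : EuclideanSpace ℝ (Fin 2)) (q : ℕ) (p : Fin 2 → ℤ) (q' : ℕ) : Prop :=
  IsLeast {m : ℕ | 1 ≤ m ∧ latticeDist v m < latticeDist v q} q' ∧
    ∀ i, |(q : ℝ) * v i - (p i : ℝ)| = distInt ((q : ℝ) * v i)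

theorem smul_ratVec {q : ℕ} (hq : 0 < q) (p : Fin 2 → ℤ) : (q : ℝ) • ratVec q p = intVec p := by
  have : (q : ℝ) ≠ 0 := by positivity
  rw [ratVec, smul_smul, mul_inv_cancel₀ this, one_smul]

theorem intVec_sub (p p' : Fin 2 → ℤ) : intVec (p - p') = intVec p - intVec p' := by
  ext i; simp [intVec]

theorem isOpen_openHalfDisc (c e : EuclideanSpace ℝ (Fin 2)) (r : ℝ) :
    IsOpen (openHalfDisc c e r) := by
  have h1 : IsOpen {v : EuclideanSpace ℝ (Fin 2) | ‖v - c‖ < r} :=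
    isOpen_lt (by fun_prop) continuous_const
  have h2 : IsOpen {v : EuclideanSpace ℝ (Fin 2) | inner ℝ (v - c) e < 0} :=
    isOpen_lt (by fun_prop) continuous_const
  exact h1.inter h2

theorem norm_smul_ratVec_sub {q' : ℕ} (hq' : 0 < q') (p' : Fin 2 → ℤ) (m : ℕ) (s : Fin 2 → ℤ) :
    ‖(m : ℝ) • ratVec q' p' - intVec s‖ ^ 2 =
      (((m * p' 0 - q' * s 0) ^ 2 + (m * p' 1 - q' * s 1) ^ 2 : ℤ) : ℝ) / (q' : ℝ) ^ 2 := by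
  have : (q' : ℝ) ≠ 0 := by positivity
  rw [norm_smul_sub_intVec, Real.sq_sqrt (by positivity)]
  simp only [ratVec, intVec, PiLp.smul_apply, smul_eq_mul]
  push_cast
  field_simp

-- Only finitely many `m < q'` compete, and all but `q' - q` lose strictly at the centre, hence
-- nearby. The tie with `q' - q` is broken by the sign of the inner product, together with `2 q ≤
-- q'`.
open Topology Filter in
theorem eventually_isNextBestApprox {q q' : ℕ} {p p' : Fin 2 → ℤ} (hq : 0 < q) (hqq' : 2 * q ≤ q')
    (hne : (q : ℝ) • ratVec q' p' - intVec p ≠ 0)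
    (hhalf : ‖(q : ℝ) • ratVec q' p' - intVec p‖ < 1 / 2)
    (hlt : ∀ m : ℕ, 0 < m → m < q' → m ≠ q → m ≠ q' - q → ∀ s : Fin 2 → ℤ,
      ‖(q : ℝ) • ratVec q' p' - intVec p‖ < ‖(m : ℝ) • ratVec q' p' - intVec s‖) :
    ∀ᶠ v in 𝓝 (ratVec q' p'),
      inner ℝ (v - ratVec q' p') ((q : ℝ) • ratVec q' p' - intVec p) < 0 →
        IsNextBestApprox v q p q' := by
  have hq' : 0 < q' := by omega
  obtain ⟨c, hc⟩ : ∃ c, c = ratVec q' p' := ⟨_, rfl⟩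
  have hc' : (q' : ℝ) • c = intVec p' := by rw [hc, smul_ratVec hq']
  rw [← hc] at hne hhalf hlt ⊢
  have hcast : ((q' - q : ℕ) : ℝ) = q' - q := by rw [Nat.cast_sub (by omega)]
  have hcont : ∀ (m : ℕ) (s : Fin 2 → ℤ), Continuous fun v : EuclideanSpace ℝ (Fin 2) =>
      ‖(m : ℝ) • v - intVec s‖ := fun m s => by fun_prop
  have hA : ∀ᶠ v in 𝓝 c, ∀ m ∈ Finset.range q', 0 < m → m ≠ q → m ≠ q' - q →
      latticeDist v q < latticeDist v m := by
    refine (Filter.eventually_all_finset _).2 fun m hm => ?_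
    by_cases h : 0 < m ∧ m ≠ q ∧ m ≠ q' - q
    · obtain ⟨h0, h1, h2⟩ := h
      have : latticeDist c q < latticeDist c m := by
        rw [latticeDist_eq_of_nearest (nearest_of_norm_lt_half hhalf), latticeDist_eq_norm_round c m]
        exact hlt m h0 (Finset.mem_range.1 hm) h1 h2 _
      filter_upwards [(continuous_latticeDist q).continuousAt.eventually_lt
        (continuous_latticeDist m).continuousAt this] with v hv _ _ _ using hv
    · exact Eventually.of_forall fun v h0 h1 h2 => absurd ⟨h0, h1, h2⟩ h
  have h1 : ∀ᶠ v in 𝓝 c, ‖(q : ℝ) • v - intVec p‖ < 1 / 2 :=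
    (hcont q p).continuousAt.eventually_lt continuousAt_const hhalf
  have h2 : ∀ᶠ v in 𝓝 c, ‖((q' - q : ℕ) : ℝ) • v - intVec (p' - p)‖ < 1 / 2 := by
    refine (hcont _ _).continuousAt.eventually_lt continuousAt_const ?_
    have : ((q' - q : ℕ) : ℝ) • c - intVec (p' - p) = -((q : ℝ) • c - intVec p) := by
      rw [hcast, intVec_sub, sub_smul, hc']; abel
    rw [this, norm_neg]; exact hhalf
  have h3 : ∀ᶠ v in 𝓝 c, ‖(q' : ℝ) • v - intVec p'‖ < 1 / 2 := by
    refine (hcont _ _).continuousAt.eventually_lt continuousAt_const ?_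
    rw [hc']; simp
  have h4 : ∀ᶠ v in 𝓝 c, ‖(q' : ℝ) • v - intVec p'‖ < ‖(q : ℝ) • v - intVec p‖ := by
    refine (hcont _ _).continuousAt.eventually_lt (hcont _ _).continuousAt ?_
    rw [hc', sub_self, norm_zero]
    exact norm_pos_iff.2 hne
  filter_upwards [hA, h1, h2, h3, h4] with v hA h1 h2 h3 h4 hv
  have n1 := nearest_of_norm_lt_half h1
  have e1 := latticeDist_eq_of_nearest n1
  have e2 := latticeDist_eq_of_nearest (nearest_of_norm_lt_half h2)
  have e3 := latticeDist_eq_of_nearest (nearest_of_norm_lt_half h3)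
  refine ⟨⟨⟨hq', by rw [e1, e3]; exact h4⟩, fun m hm => ?_⟩, n1⟩
  by_contra! hmq'
  obtain ⟨hm0, hm⟩ := hm
  by_cases hmq : m = q
  · exact absurd hm (by rw [hmq]; exact lt_irrefl _)
  by_cases hmq2 : m = q' - q
  · rw [hmq2, e2, e1] at hm
    refine absurd hm (not_lt.2 ?_)
    -- With `δ = v - c` and `y = q δ + (q c - p)`, the claim is `|y| ≤ |q' δ - y|`; expanding the
    -- square leaves `(q' - 2 q) |δ|² - 2 ⟨δ, q c - p⟩ ≥ 0`.
    have d1 : ((q' - q : ℕ) : ℝ) • v - intVec (p' - p) =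
        (q' : ℝ) • (v - c) - ((q : ℝ) • (v - c) + ((q : ℝ) • c - intVec p)) := by
      rw [hcast, intVec_sub, ← hc']; module
    have d2 : (q : ℝ) • v - intVec p = (q : ℝ) • (v - c) + ((q : ℝ) • c - intVec p) := by
      module
    rw [d1, d2]
    refine (sq_le_sq₀ (norm_nonneg _) (norm_nonneg _)).1 ?_
    rw [norm_sub_sq_real (F := EuclideanSpace ℝ (Fin 2)), inner_add_right, real_inner_smul_left,
      real_inner_smul_right, real_inner_smul_left, real_inner_self_eq_norm_sq, norm_smul, mul_pow,
      Real.norm_natCast]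
    have h5 : (2 * q : ℝ) ≤ q' := by exact_mod_cast hqq'
    have h6 : (0 : ℝ) < q' := by exact_mod_cast hq'
    have h7 := mul_nonneg (mul_nonneg h6.le (sub_nonneg.2 h5)) (sq_nonneg ‖v - c‖)
    have h8 := mul_neg_of_pos_of_neg h6 hv
    linarith
  · exact absurd hm (hA m (Finset.mem_range.2 hmq') hm0 hmq hmq2).not_gt

/-- A completion of `(q, p)` to a basis of `ℤ³` can be chosen so that the projection of its second
vector along the first lies strictly on the side of a given line opposite to `e`. -/
theorem ExtendsToBasis.exists_neg {q : ℕ} {p : Fin 2 → ℤ} (h : ExtendsToBasis q p) (hq : 0 < q)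
    {e : EuclideanSpace ℝ (Fin 2)} (he : e ≠ 0) :
    ∃ U S T W V R : ℤ, q * (S * R - T * V) - p 0 * (U * R - T * W) + p 1 * (U * V - S * W) = 1 ∧
      ((q * S - U * p 0 : ℤ) : ℝ) * e 0 + ((q * T - U * p 1 : ℤ) : ℝ) * e 1 < 0 := by
  obtain ⟨U, S, T, W, V, R, h⟩ := h
  have hq0 : (q : ℝ) ≠ 0 := by positivity
  have hr : (q * (S * R - T * V) - p 0 * (U * R - T * W) + p 1 * (U * V - S * W) : ℝ) = 1 := by
    exact_mod_cast h
  rcases lt_trichotomy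
    (((q * S - U * p 0 : ℤ) : ℝ) * e 0 + ((q * T - U * p 1 : ℤ) : ℝ) * e 1) 0 with h1 | h1 | h1
  · exact ⟨U, S, T, W, V, R, h, h1⟩
  · rcases lt_trichotomy
      (((q * V - W * p 0 : ℤ) : ℝ) * e 0 + ((q * R - W * p 1 : ℤ) : ℝ) * e 1) 0 with h2 | h2 | h2
    · exact ⟨W, V, R, -U, -S, -T, by linear_combination h, h2⟩
    · refine absurd ?_ he
      push_cast at h1 h2
      -- Cramer's rule: the two projected vectors are independent, so `e` cannot be orthogonal to
      -- both.
      have e0 : (q : ℝ) * e 0 = 0 := by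
        linear_combination (q * R - W * p 1) * h1 - (q * T - U * p 1) * h2 - q * e 0 * hr
      have e1 : (q : ℝ) * e 1 = 0 := by
        linear_combination (q * S - U * p 0) * h2 - (q * V - W * p 0) * h1 - q * e 1 * hr
      ext i
      fin_cases i
      · simpa [hq0] using e0
      · simpa [hq0] using e1
    · refine ⟨-W, -V, -R, U, S, T, by linear_combination h, ?_⟩
      push_cast at h2 ⊢; linarith
  · refine ⟨-U, -S, -T, -W, -V, -R, by linear_combination h, ?_⟩
    push_cast at h1 ⊢; linarith

-- For large `k` the displacement from `p / q` to the new centre is dominated by the projection of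
-- `u`, chosen on the allowed side of the line.
open Topology Filter in
theorem exists_next_halfDisc {q : ℕ} {p : Fin 2 → ℤ} (hq : 0 < q) (hqp : ExtendsToBasis q p)
    {e : EuclideanSpace ℝ (Fin 2)} (he : e ≠ 0) {r : ℝ} (hr : 0 < r) {a b : ℝ} (ha : 0 < a)
    (hab : a < b) (hb : b < 2 / √3) :
    ∃ (q' : ℕ) (p' : Fin 2 → ℤ) (e' : EuclideanSpace ℝ (Fin 2)) (r' : ℝ), 0 < q' ∧
      ExtendsToBasis q' p' ∧ e' ≠ 0 ∧ 0 < r' ∧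
      Metric.closedBall (ratVec q' p') r' ⊆ openHalfDisc (ratVec q p) e r ∧
      ∀ v ∈ openHalfDisc (ratVec q' p') e' r', IsNextBestApprox v q p q' ∧
        (q' : ℝ) * ‖(q : ℝ) • v - intVec p‖ ^ 2 ∈ Set.Ioo a b := by
  obtain ⟨U, S, T, W, V, R, hdet, hneg⟩ := hqp.exists_neg hq he
  have hb0 : 0 < b := ha.trans hab
  have hq0 : (0 : ℝ) < q := by positivity
  have hb2 : b ^ 2 < 4 / 3 := by
    have : b ^ 2 < (2 / √3) ^ 2 := pow_lt_pow_left₀ hb hb0.le two_ne_zero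
    rw [div_pow, Real.sq_sqrt (by norm_num)] at this
    linarith
  obtain ⟨ρ, hρ⟩ : ∃ ρ : ℝ, ρ = min (r * q) (1 / 2) := ⟨_, rfl⟩
  have hρ0 : 0 < ρ := by rw [hρ]; exact lt_min (by positivity) (by norm_num)
  have hA : 0 < (q * S - U * p 0) ^ 2 + (q * T - U * p 1) ^ 2 := by
    by_contra! hcon
    have h1 : q * S - U * p 0 = 0 := by nlinarith
    have h2 : q * T - U * p 1 = 0 := by nlinarith
    rw [h1, h2] at hneg
    simp at hneg
  have hL : ∀ᶠ k : ℕ in atTop, (k : ℝ) * (((q * S - U * p 0 : ℤ) : ℝ) * e 0 +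
      ((q * T - U * p 1 : ℤ) : ℝ) * e 1) + (((q * V - W * p 0 : ℤ) : ℝ) * e 0 +
      ((q * R - W * p 1 : ℤ) : ℝ) * e 1) < 0 :=
    (tendsto_atBot_add_const_right _ _
      (tendsto_natCast_atTop_atTop.atTop_mul_const_of_neg hneg)).eventually_lt_atBot 0
  -- `Q ≥ b / ρ²` forces `|q c - p|² = N / Q² < ρ²`, which puts `c` within `r` of `p / q` and makes
  -- `p` nearest to `q c`; `Q ≥ 2 q` serves the tie-break.
  obtain ⟨k, hk, j, Q, N, I, hQ, hN, hI, haQ, hbQ, hKQ, hN0, hIN⟩ :=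
    (hL.and (eventually_exists_int_combination (q * S - U * p 0) (q * T - U * p 1)
      (q * V - W * p 0) (q * R - W * p 1) (U * V - W * S) (U * R - W * T) U W q hA
      (by exact_mod_cast hq) ha hab hb2 (max (b / ρ ^ 2) (2 * q)))).exists
  have hKQ1 : b / ρ ^ 2 ≤ Q := (le_max_left _ _).trans hKQ
  have hKQ2 : (2 * q : ℝ) ≤ Q := (le_max_right _ _).trans hKQ
  have hqQ : 2 * (q : ℤ) ≤ Q := by exact_mod_cast hKQ2
  lift Q to ℕ using (by omega)
  have hqQ : 2 * q ≤ Q := by exact_mod_cast hqQ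
  have hQ0 : 0 < Q := by omega
  have hQr : (0 : ℝ) < Q := by exact_mod_cast hQ0
  push_cast at haQ hbQ hKQ1
  obtain ⟨X, hX⟩ : ∃ X : ℤ, X = k * S + V + j * p 0 := ⟨_, rfl⟩
  obtain ⟨Y, hY⟩ : ∃ Y : ℤ, Y = k * T + R + j * p 1 := ⟨_, rfl⟩
  have hL0 : q * X - Q * p 0 = k * (q * S - U * p 0) + (q * V - W * p 0) := by rw [hX, hQ]; ring
  have hL1 : q * Y - Q * p 1 = k * (q * T - U * p 1) + (q * R - W * p 1) := by rw [hY, hQ]; ring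
  have hN' : N = (q * X - Q * p 0) ^ 2 + (q * Y - Q * p 1) ^ 2 := by rw [hL0, hL1, hN]
  have hdet' : Q * (p 0 * T - p 1 * S) - X * (q * T - p 1 * U) + Y * (q * S - p 0 * U) = 1 := by
    rw [hX, hY, hQ]; linear_combination hdet
  have hnorm : ‖(q : ℝ) • ratVec Q ![X, Y] - intVec p‖ ^ 2 = N / (Q : ℝ) ^ 2 := by
    rw [norm_smul_ratVec_sub hQ0, hN']; simp
  have hnρ : ‖(q : ℝ) • ratVec Q ![X, Y] - intVec p‖ < ρ := by
    refine (sq_lt_sq₀ (norm_nonneg _) hρ0.le).1 ?_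
    rw [hnorm, div_lt_iff₀ (by positivity)]
    rw [div_le_iff₀ (by positivity)] at hKQ1
    calc (N : ℝ) < b * Q := hbQ
      _ ≤ Q * ρ ^ 2 * Q := mul_le_mul_of_nonneg_right hKQ1 hQr.le
      _ = ρ ^ 2 * Q ^ 2 := by ring
  have hne : (q : ℝ) • ratVec Q ![X, Y] - intVec p ≠ 0 := by
    intro h0
    rw [h0, norm_zero] at hnorm
    have : (0 : ℝ) < N / (Q : ℝ) ^ 2 := by
      have : (0 : ℝ) < N := by exact_mod_cast hN0
      positivity
    rw [← hnorm] at this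
    norm_num at this
  have hN2 : N < 2 * Q := by
    have : (N : ℝ) < 2 * Q := by
      have : b < 2 := by nlinarith
      exact hbQ.trans (mul_lt_mul_of_pos_right this hQr)
    exact_mod_cast this
  have hev := eventually_isNextBestApprox hq hqQ hne
    (hnρ.trans_le (by rw [hρ]; exact min_le_right _ _)) (fun m hm0 hmQ hmq hmQq s => by
      refine (sq_lt_sq₀ (norm_nonneg _) (norm_nonneg _)).1 ?_
      rw [hnorm, norm_smul_ratVec_sub hQ0]
      refine div_lt_div_of_pos_right ?_ (by positivity)
      exact_mod_cast lt_sq_add_sq_of_det_eq_one hdet' hN'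
        (show I = _ by rw [hL0, hL1, hI, hX, hY, hQ]; ring) hN0 hN2 hIN (by exact_mod_cast hm0)
        (by exact_mod_cast hmQ) (by exact_mod_cast hmq) (by omega) (by exact_mod_cast hq)
        (by omega))
  have hvol : ∀ᶠ v in 𝓝 (ratVec Q ![X, Y]),
      (Q : ℝ) * ‖(q : ℝ) • v - intVec p‖ ^ 2 ∈ Set.Ioo a b := by
    have hcont : Continuous fun v : EuclideanSpace ℝ (Fin 2) =>
        (Q : ℝ) * ‖(q : ℝ) • v - intVec p‖ ^ 2 := by fun_prop
    refine hcont.continuousAt.eventually_mem (isOpen_Ioo.mem_nhds ?_)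
    rw [hnorm]
    have : (Q : ℝ) * (N / (Q : ℝ) ^ 2) = N / Q := by field_simp
    rw [this]
    exact ⟨(lt_div_iff₀ hQr).2 haQ, (div_lt_iff₀ hQr).2 hbQ⟩
  have hmem : ratVec Q ![X, Y] ∈ openHalfDisc (ratVec q p) e r := by
    have hsub : ratVec Q ![X, Y] - ratVec q p =
        (q : ℝ)⁻¹ • ((q : ℝ) • ratVec Q ![X, Y] - intVec p) := by
      rw [smul_sub, smul_smul, inv_mul_cancel₀ hq0.ne', one_smul]; rfl
    constructor
    · rw [hsub, norm_smul, norm_inv, Real.norm_natCast, inv_mul_lt_iff₀ hq0, mul_comm]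
      exact hnρ.trans_le (by rw [hρ]; exact min_le_left _ _)
    · rw [hsub, real_inner_smul_left]
      refine mul_neg_of_pos_of_neg (inv_pos.2 hq0) ?_
      have hcoord : inner ℝ ((q : ℝ) • ratVec Q ![X, Y] - intVec p) e =
          (Q : ℝ)⁻¹ * (((q * X - Q * p 0 : ℤ) : ℝ) * e 0 + ((q * Y - Q * p 1 : ℤ) : ℝ) * e 1) := by
        simp only [PiLp.inner_apply, Fin.sum_univ_two, ratVec, intVec, PiLp.sub_apply,
          PiLp.smul_apply, smul_eq_mul, RCLike.inner_apply, conj_trivial, Matrix.cons_val_zero,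
          Matrix.cons_val_one]
        push_cast
        field_simp
      rw [hcoord, hL0, hL1]
      refine mul_neg_of_pos_of_neg (inv_pos.2 hQr) ?_
      push_cast at hk ⊢
      linarith
  obtain ⟨r₁, hr₁, h₁⟩ := Metric.nhds_basis_closedBall.mem_iff.1
    ((hev.and hvol).and ((isOpen_openHalfDisc _ _ _).mem_nhds hmem))
  -- The old vector `z` and `u` complete the new one to a basis.
  refine ⟨Q, ![X, Y], _, r₁, hQ0, ⟨q, p 0, p 1, U, S, T, ?_⟩, hne, hr₁, fun v hv => (h₁ hv).2,
    fun v hv => ?_⟩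
  · simp only [Matrix.cons_val_zero, Matrix.cons_val_one]
    linear_combination hdet'
  · have := (h₁ (mem_closedBall_iff_norm.2 hv.1.le)).1
    exact ⟨this.1 hv.2, this.2⟩

/-! ### Nested discs and their common point. -/

/-- The data carried from one best approximation to the next: `(q, p)` is completable to a basis,
and the vectors `v` under consideration are confined to a half-disc at `p / q`. -/
structure ApproxStage where
  q : ℕ
  p : Fin 2 → ℤ
  e : EuclideanSpace ℝ (Fin 2)
  r : ℝ
  q_pos : 0 < q
  extends_basis : ExtendsToBasis q p
  e_ne : e ≠ 0
  r_pos : 0 < r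

/-- The vectors allowed by a stage. -/
def ApproxStage.region (s : ApproxStage) : Set (EuclideanSpace ℝ (Fin 2)) :=
  openHalfDisc (ratVec s.q s.p) s.e s.r

/-- The closed disc containing the vectors allowed by a stage. -/
def ApproxStage.disc (s : ApproxStage) : Set (EuclideanSpace ℝ (Fin 2)) :=
  Metric.closedBall (ratVec s.q s.p) s.r

theorem ApproxStage.region_subset_disc (s : ApproxStage) : s.region ⊆ s.disc :=
  fun _ hv => mem_closedBall_iff_norm.2 hv.1.le

theorem ApproxStage.exists_next (s : ApproxStage) {a b : ℝ} (ha : 0 < a) (hab : a < b)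
    (hb : b < 2 / √3) :
    ∃ t : ApproxStage, t.disc ⊆ s.region ∧ ∀ v ∈ t.region, IsNextBestApprox v s.q s.p t.q ∧
      (t.q : ℝ) * ‖(s.q : ℝ) • v - intVec s.p‖ ^ 2 ∈ Set.Ioo a b := by
  obtain ⟨q', p', e', r', h1, h2, h3, h4, h5, h6⟩ :=
    exists_next_halfDisc s.q_pos s.extends_basis s.e_ne s.r_pos ha hab hb
  exact ⟨⟨q', p', e', r', h1, h2, h3, h4⟩, h5, h6⟩

theorem exists_isBestApproxSeq_mem_Ioo {a b : ℕ → ℝ} (ha : ∀ n, 0 < a n) (hab : ∀ n, a n < b n)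
    (hb : ∀ n, b n < 2 / √3) :
    ∃ (v : EuclideanSpace ℝ (Fin 2)) (q : ℕ → ℕ) (p : ℕ → Fin 2 → ℤ), IsBestApproxSeq v q p ∧
      ∀ n, (q (n + 1) : ℝ) * ‖(q n : ℝ) • v - intVec (p n)‖ ^ 2 ∈ Set.Ioo (a n) (b n) := by
  choose f hf1 hf2 using fun (n : ℕ) (s : ApproxStage) => s.exists_next (ha n) (hab n) (hb n)
  have he : (EuclideanSpace.single 0 1 : EuclideanSpace ℝ (Fin 2)) ≠ 0 := by simp
  let s₀ : ApproxStage := ⟨1, 0, EuclideanSpace.single 0 1, 1, one_pos,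
    ⟨0, 1, 0, 0, 0, 1, by simp⟩, he, one_pos⟩
  let s : ℕ → ApproxStage := fun n => Nat.rec s₀ (fun n t => f n t) n
  have hs : ∀ n, s (n + 1) = f n (s n) := fun n => rfl
  have hdisc : ∀ n, (s (n + 1)).disc ⊆ (s n).region := fun n => by rw [hs]; exact hf1 n (s n)
  obtain ⟨v, hv⟩ : (⋂ n, (s n).disc).Nonempty :=
    IsCompact.nonempty_iInter_of_sequence_nonempty_isCompact_isClosed _
      (fun n => (hdisc n).trans (s n).region_subset_disc)
      (fun n => Metric.nonempty_closedBall.2 (s n).r_pos.le)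
      (isCompact_closedBall _ _) (fun n => Metric.isClosed_closedBall)
  -- The closed discs give a limit by compactness; lying in the next disc puts it in the current
  -- open half-disc. The radii need not tend to zero.
  have hreg : ∀ n, v ∈ (s n).region := fun n => hdisc n (Set.mem_iInter.1 hv (n + 1))
  have hnext := fun n => hf2 n (s n) v (hreg (n + 1))
  exact ⟨v, fun n => (s n).q, fun n => (s n).p, ⟨rfl, fun n => (hnext n).1.1,
    fun n => (hnext n).1.2⟩, fun n => (hnext n).2⟩

/-! ### Continuum many vectors. -/

theorem one_div_pi_mul_cylVolume (v : EuclideanSpace ℝ (Fin 2)) (q : ℕ → ℕ) (p : ℕ → Fin 2 → ℤ)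
    (n : ℕ) : 1 / Real.pi * cylVolume v q p (n + 1) =
      q (n + 1) * ‖(q n : ℝ) • v - intVec (p n)‖ ^ 2 := by
  have := Real.pi_ne_zero
  simp only [cylVolume, cylRadius]
  field_simp

theorem IsBestApproxSeq.unique {v : EuclideanSpace ℝ (Fin 2)} {q q' : ℕ → ℕ}
    {p p' : ℕ → Fin 2 → ℤ} (h : IsBestApproxSeq v q p) (h' : IsBestApproxSeq v q' p') (n : ℕ) :
    q n = q' n := by
  induction n with
  | zero => rw [h.q_zero, h'.q_zero]
  | succ n ih =>
    have := h.q_succ n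
    rw [ih] at this
    exact this.unique (h'.q_succ n)

/-- The volumes of the cylinders depend only on the vector. -/
theorem IsBestApproxSeq.mul_norm_sq_unique {v : EuclideanSpace ℝ (Fin 2)} {q q' : ℕ → ℕ}
    {p p' : ℕ → Fin 2 → ℤ} (h : IsBestApproxSeq v q p) (h' : IsBestApproxSeq v q' p') (n : ℕ) :
    (q (n + 1) : ℝ) * ‖(q n : ℝ) • v - intVec (p n)‖ ^ 2 =
      q' (n + 1) * ‖(q' n : ℝ) • v - intVec (p' n)‖ ^ 2 := by
  rw [← latticeDist_eq_of_nearest (h.p_nearest n), ← latticeDist_eq_of_nearest (h'.p_nearest n),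
    h.unique h' n, h.unique h' (n + 1)]

theorem mk_euclideanPlane_le : Cardinal.mk (EuclideanSpace ℝ (Fin 2)) ≤ Cardinal.continuum := by
  have hinj : Function.Injective fun v : EuclideanSpace ℝ (Fin 2) => (v 0, v 1) := by
    intro v w h
    simp only [Prod.mk.injEq] at h
    ext i
    fin_cases i
    exacts [h.1, h.2]
  simpa [Cardinal.mk_real] using Cardinal.mk_le_of_injective hinj

theorem mainTheorem2 (Δ : ℕ → Set ℝ)
    (hΔ_interval : ∀ n, 1 ≤ n → (Δ n).OrdConnected)
    (hΔ_nondegenerate : ∀ n, 1 ≤ n → (Δ n).Nontrivial)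
    (hΔ_subset : ∀ n, 1 ≤ n → Δ n ⊆ Set.Icc 0 (2 / √3)) :
    Cardinal.mk {v : EuclideanSpace ℝ (Fin 2) |
      ∃ (q : ℕ → ℕ) (p : ℕ → Fin 2 → ℤ), IsBestApproxSeq v q p ∧
        ∀ n, 1 ≤ n → 1 / Real.pi * cylVolume v q p n ∈ Δ n} = Cardinal.continuum := by
  refine le_antisymm ((Cardinal.mk_set_le _).trans mk_euclideanPlane_le) ?_
  have hxy : ∀ n, ∃ x d : ℝ, 0 ≤ x ∧ 0 < d ∧ x + 4 * d ≤ 2 / √3 ∧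
      Set.Icc x (x + 4 * d) ⊆ Δ (n + 1) := by
    intro n
    obtain ⟨x, hx, y, hy, hlt⟩ := (hΔ_nondegenerate (n + 1) (by omega)).exists_lt
    have hy' : x + 4 * ((y - x) / 4) = y := by ring
    refine ⟨x, (y - x) / 4, (hΔ_subset (n + 1) (by omega) hx).1, by linarith, ?_, ?_⟩
    · rw [hy']; exact (hΔ_subset (n + 1) (by omega) hy).2
    · rw [hy']; exact (hΔ_interval (n + 1) (by omega)).out hx hy
  choose x d hx hd hxd hΔ using hxy
  -- The middle two quarters of the interval `[x, x + 4 d]` are the two targets; skipping the outer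
  -- quarters keeps them away from `0` and `2 / √3`.
  let u : (ℕ → Bool) → ℕ → ℝ := fun β n => x n + (if β n then 2 else 1) * d n
  have hu : ∀ β n, x n + d n ≤ u β n ∧ u β n + d n ≤ x n + 3 * d n := by
    intro β n
    have := hd n
    by_cases h : β n <;> simp only [u, h] <;> constructor <;> norm_num <;> linarith
  have hex := fun β : ℕ → Bool => exists_isBestApproxSeq_mem_Ioo (a := u β)
    (b := fun n => u β n + d n)
    (fun n => by linarith [hu β n, hx n, hd n])
    (fun n => by linarith [hd n])
    (fun n => by linarith [hu β n, hxd n, hd n])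
  choose v q p hqp hmem using hex
  have hinj : Function.Injective v := by
    intro β γ hβγ
    funext n
    have h1 := hmem β n
    have h2 := hmem γ n
    have hγ := hqp γ
    rw [← hβγ] at hγ h2
    rw [(hqp β).mul_norm_sq_unique hγ n] at h1
    obtain ⟨h3, h4⟩ := h1
    obtain ⟨h5, h6⟩ := h2
    by_contra hne
    have := hd n
    cases hb : β n <;> cases hc : γ n <;> simp only [hb, hc, u] at h3 h4 h5 h6 hne <;>
      norm_num at h3 h4 h5 h6 hne <;> linarith
  have hV : ∀ β, v β ∈ {v : EuclideanSpace ℝ (Fin 2) |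
      ∃ (q : ℕ → ℕ) (p : ℕ → Fin 2 → ℤ), IsBestApproxSeq v q p ∧
        ∀ n, 1 ≤ n → 1 / Real.pi * cylVolume v q p n ∈ Δ n} := by
    refine fun β => ⟨q β, p β, hqp β, fun n hn => ?_⟩
    obtain ⟨n, rfl⟩ := Nat.exists_eq_add_of_le' hn
    rw [one_div_pi_mul_cylVolume]
    refine hΔ n ?_
    obtain ⟨h1, h2⟩ := hmem β n
    have := hd n
    have := hu β n
    exact ⟨by linarith, by linarith⟩
  have := Cardinal.mk_le_of_injective (f := fun β : ℕ → Bool => (⟨v β, hV β⟩ : {v : EuclideanSpace ℝ (Fin 2) |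
      ∃ (q : ℕ → ℕ) (p : ℕ → Fin 2 → ℤ), IsBestApproxSeq v q p ∧
        ∀ n, 1 ≤ n → 1 / Real.pi * cylVolume v q p n ∈ Δ n}))
    fun β γ h => hinj (Subtype.ext_iff.1 h)
  have hc : Cardinal.mk (ℕ → Bool) = Cardinal.continuum := by simp
  rwa [hc] at this
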